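/- A probability on $\mathbb Z^+=\{0,1,2,\dots\}$ is a function $F\colon\mathbb Z^+\to[0,1]$ with $\sum_{k\ge 0}F(k)=1$. Let $F^{(n)}$ be its $n$-th convolution power ($F^{(0)}=\delta_0$), let $\|F\|_1=\sum_k|F(k)|$, and let $\widehat F(\xi)=\sum_{k\ge0}F(k)e^{-ik\xi}$ for $\xi\in[-\pi,\pi]$. Let $\mathcal A$ be the set of all probabilities $F$ on $\mathbb Z^+$ with $\sup_{n\ge1}n\|F^{(n)}-F^{(n+1)}\|_1<\infty$. A probability $F$ on $\mathbb Z^+$ is aperiodic if for every $m\in\mathbb Z$ the set $\{m+k: F(k)\ne0\}$ generates the additive group $\mathbb Z$. For $\alpha\in(0,1)$ put $A_\alpha(0)=0$ and $$A_\alpha(k)=\frac{\alpha(1-\alpha)(2-\alpha)\cdots((k-1)-\alpha)}{k!}\qquad(k\ge1).$$ For $\alpha\in(0,1)$, consider the following two conditions. (I) (on a probability $F$ on $\mathbb Z^+$) $F$ is aperiodic, there is $\delta\in(0,1)$ such that $1-\operatorname{Re}\widehat F(\xi)\ge\delta|\xi|^\alpha$ for all $\xi\in[-\delta,\delta]$,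 and there is $c>0$ such that $$\widehat F\text{ is differentiable at }\xi\text{ and }|\partial_\xi\widehat F(\xi)|\le c|\xi|^{\alpha-1}\quad\text{for all }\xi\in[-\pi,\pi]\setminus\{0\}.\tag{$*$}$$ (II) (on a probability $G$ on $\mathbb Z^+$) $G$ is aperiodic, and there are a probability $F$ on $\mathbb Z^+$ that satisfies (I) with the same $\alpha$ and a number $a>0$ such that $\sum_{k\ge1}k|G(k)-aF(k)|<\infty$. (At $\xi=\pm\pi$ the derivative is one-sided.) **Theorem.** Fix $\varepsilon\in(0,1]$ and let $B=\varepsilon^{-1}\int_0^\varepsilon A_\alpha\,d\alpha$, that is, $B(k)=\varepsilon^{-1}\int_0^\varepsilon A_\alpha(k)\,d\alpha$ for each $k$. Then $B$ is a probability on $\mathbb Z^+$. For $\beta\in(0,1)$ let $B_\beta=\sum_{k\ge0}A_\beta(k)B^{(k)}$. Then $B_\beta\in\mathcal A$, one has $\widehat{B_\beta}(\xi)\ne1$ for all $\xi\neq0$ close enough to $0$, and for every $\alpha\in(0,1)$ $$\lim_{\xi\to0}\frac{|\xi|^\alpha}{|1-\widehat{B_\beta}(\xi)|}=0 .$$ Consequently,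 for no $\alpha\in(0,1)$ does $B_\beta$ satisfy $(*)$ with any $c>0$; in particular, for no $\alpha\in(0,1)$ does $F=B_\beta$ satisfy (I), or $G=B_\beta$ satisfy (II). -/

import Mathlib

open Filter Topology
open scoped ENNReal

noncomputable section

namespace RittProb

/-- Probabilities on `ℤ⁺ = {0, 1, 2, …}`, as functions `ℕ → ℝ`. -/
def IsProb (F : ℕ → ℝ) : Prop :=
  (∀ k, 0 ≤ F k) ∧ HasSum F 1

/-- Convolution of functions on `ℤ⁺` (that is, of functions on `ℤ` supported in `ℤ⁺`). -/
def conv (F G : ℕ → ℝ) (m : ℕ) : ℝ :=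
  ∑ p ∈ Finset.HasAntidiagonal.antidiagonal m, F p.1 * G p.2

/-- The unit `δ₀` for convolution. -/
def delta0 : ℕ → ℝ := Pi.single 0 1

/-- The `n`-th convolution power `F⁽ⁿ⁾`, with `F⁽⁰⁾ = δ₀`. -/
def convPow (F : ℕ → ℝ) : ℕ → ℕ → ℝ
  | 0 => delta0
  | n + 1 => conv F (convPow F n)

/-- The `L¹` norm, with values in `[0, ∞]`. -/
def l1Norm (F : ℕ → ℝ) : ℝ≥0∞ := ∑' k, ENNReal.ofReal |F k|

/-- The class `𝒜` of Ritt probabilities: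
`F` is a probability on `ℤ⁺` and `sup_{n ≥ 1} n ‖F⁽ⁿ⁾ - F⁽ⁿ⁺¹⁾‖₁ < ∞`. -/
def classA : Set (ℕ → ℝ) :=
  {F | IsProb F ∧
    (⨆ n : ℕ, ⨆ _ : 1 ≤ n,
      (n : ℝ≥0∞) * l1Norm (convPow F n - convPow F (n + 1)) : ℝ≥0∞) < ∞}

/-- The Fourier transform `F̂(ξ) = ∑_k F(k) e^{-ikξ}`. -/
def fourier (F : ℕ → ℝ) (ξ : ℝ) : ℂ :=
  ∑' k : ℕ, (F k : ℂ) * Complex.exp (-(Complex.I * k * ξ))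

/-- `A_α(0) = 0` and `A_α(k) = α (1 - α) (2 - α) ⋯ ((k - 1) - α) / k!` for `k ≥ 1`. -/
def A (α : ℝ) (k : ℕ) : ℝ :=
  if k = 0 then 0 else α * (∏ j ∈ Finset.Ico 1 k, ((j : ℝ) - α)) / (k.factorial : ℝ)

/-- `B = ε⁻¹ ∫_0^ε A_α dα`. At each `k` the integrand is a polynomial in `α`. -/
def B (ε : ℝ) (k : ℕ) : ℝ := ε⁻¹ * ∫ α in (0 : ℝ)..ε, A α k

/-- `B_β = ∑_{k ≥ 0} A_β(k) B⁽ᵏ⁾`. -/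
def Bsub (ε β : ℝ) (m : ℕ) : ℝ := ∑' k : ℕ, A β k * convPow (B ε) k m

/-- `F` is aperiodic: for every `m ∈ ℤ` the support of the translate `δ_m * F`
generates the additive group `ℤ`. -/
def IsAperiodic (F : ℕ → ℝ) : Prop :=
  ∀ m : ℤ, AddSubgroup.closure {j : ℤ | ∃ k : ℕ, F k ≠ 0 ∧ j = m + k} = ⊤

/-- For some `c > 0`, `F̂` is differentiable on `[-π, π] \ {0}` with
`|∂_ξ F̂(ξ)| ≤ c |ξ|^{α - 1}` there. At `±π` the derivative is the one-sided one,
as `F̂` is regarded as a function on `[-π, π]`. -/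
def DerivBound (α : ℝ) (F : ℕ → ℝ) : Prop :=
  ∃ c : ℝ, 0 < c ∧ ∀ ξ ∈ Set.Icc (-Real.pi) Real.pi, ξ ≠ 0 →
    DifferentiableWithinAt ℝ (fourier F) (Set.Icc (-Real.pi) Real.pi) ξ ∧
    ‖derivWithin (fourier F) (Set.Icc (-Real.pi) Real.pi) ξ‖ ≤ c * |ξ| ^ (α - 1)

/-- For some `ε ∈ (0, 1)`, `1 - Re F̂(ξ) ≥ ε |ξ|^α` for all `ξ ∈ [-ε, ε]`. -/
def RealPartBound (α : ℝ) (F : ℕ → ℝ) : Prop :=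
  ∃ ε ∈ Set.Ioo (0 : ℝ) 1, ∀ ξ ∈ Set.Icc (-ε) ε, ε * |ξ| ^ α ≤ 1 - (fourier F ξ).re

/-- The Fourier-transform criterion with exponent `α` for membership of `F` in `𝒜`. -/
def FourierCriterion (α : ℝ) (F : ℕ → ℝ) : Prop :=
  IsProb F ∧ IsAperiodic F ∧ RealPartBound α F ∧ DerivBound α F

/-- The comparison criterion with exponent `α` for membership of `G` in `𝒜`: `G` is an
aperiodic probability with `∑_k k |G(k) - a F(k)| < ∞` for some `a > 0` and some `F`
that satisfies the Fourier-transform criterion with exponent `α`. -/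
def ComparisonCriterion (α : ℝ) (G : ℕ → ℝ) : Prop :=
  IsProb G ∧ IsAperiodic G ∧ ∃ F : ℕ → ℝ, FourierCriterion α F ∧
    ∃ a : ℝ, 0 < a ∧ Summable fun k : ℕ => (k : ℝ) * |G k - a * F k|

end RittProb

end

/-!
For `‖z‖ ≤ 1` the generating function of `A_α` is `1 - (1 - z)^α`, so averaging over `α` gives
`1 - B̂(ξ) = ε⁻¹ ∫_0^ε (1 - e^{-iξ})^α dα`. The integrand has nonnegative real part, and already
the range `α ≤ δ` contributes a multiple of `|ξ|^δ`; since `δ` may be arbitrarily small and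
`1 - B̂_β = (1 - B̂)^β`, the function `1 - B̂_β` dominates every positive power of `|ξ|` at `0`.
On the other hand both `(*)` and comparison with a probability satisfying `(*)` bound `1 - B̂_β`
by a multiple of `|ξ|^α`.

Subordination `a ↦ ∑_k a(k) B⁽ᵏ⁾` contracts the `ℓ¹` norm and respects convolution powers, so
`B_β ∈ 𝒜` reduces to `A_β ∈ 𝒜`. For the latter put `h_n = F⁽ⁿ⁾ - F⁽ⁿ⁺¹⁾`, `F = A_β`, and cut at
`N ≈ n^{1/β}`. Below `N`, `|Â_β(ξ)| ≤ exp (-b |ξ|^β)` and Fourier inversion give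
`sup_k |h_n(k)| = O(1 / (n N))`. Above `N`, the identity `k h_{n+1}(k) = (jF(j) * u_n)(k)` with
`u_n = (n + 1) h_n - F⁽ⁿ⁺¹⁾` bounds the `ℓ¹` tail by `1 / (4n)` times the norm of `u_n`, a
contraction that closes an induction on `n`.
-/

namespace RittProb

/-- The product `∏_{j=1}^N (1 - α/j)`. For `0 < α ≤ 1` it is the tail `∑_{k>N} A_α(k)`, which is
how it enters the estimates. -/
noncomputable def tailProd (α : ℝ) (N : ℕ) : ℝ := ∏ j ∈ Finset.range N, (1 - α / ((j : ℝ) + 1))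

lemma tailProd_zero (α : ℝ) : tailProd α 0 = 1 := Finset.prod_range_zero _

lemma tailProd_succ (α : ℝ) (N : ℕ) :
    tailProd α (N + 1) = tailProd α N * (1 - α / ((N : ℝ) + 1)) :=
  Finset.prod_range_succ _ _

lemma A_zero (α : ℝ) : A α 0 = 0 := if_pos rfl

lemma A_succ (α : ℝ) (k : ℕ) : A α (k + 1) = α / ((k : ℝ) + 1) * tailProd α k := by
  induction k with
  | zero => simp [A, tailProd]
  | succ k ih =>
    have hrec : A α (k + 2) = A α (k + 1) * (((k : ℝ) + 1 - α) / ((k : ℝ) + 2)) := by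
      simp only [A, Nat.add_eq_zero_iff, one_ne_zero, OfNat.ofNat_ne_zero, and_false, if_false]
      rw [Finset.prod_Ico_succ_top (by omega), Nat.factorial_succ (k + 1)]
      have : ((k + 1).factorial : ℝ) ≠ 0 := by positivity
      push_cast
      field_simp
      ring
    rw [hrec, ih, tailProd_succ]
    push_cast
    field_simp
    ring

lemma tailProd_nonneg {α : ℝ} (h1 : α ≤ 1) (N : ℕ) : 0 ≤ tailProd α N := by
  refine Finset.prod_nonneg fun j _ => sub_nonneg.2 ?_
  exact div_le_one_of_le₀ (h1.trans (by simp)) (by positivity)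

lemma A_nonneg {α : ℝ} (h0 : 0 ≤ α) (h1 : α ≤ 1) (k : ℕ) : 0 ≤ A α k := by
  cases k with
  | zero => exact (A_zero α).ge
  | succ k =>
    rw [A_succ]
    exact mul_nonneg (by positivity) (tailProd_nonneg h1 k)

lemma sum_range_succ_A (α : ℝ) (N : ℕ) :
    ∑ k ∈ Finset.range (N + 1), A α k = 1 - tailProd α N := by
  induction N with
  | zero => simp [A_zero, tailProd_zero]
  | succ N ih => rw [Finset.sum_range_succ, ih, A_succ, tailProd_succ]; ring

lemma sum_range_tailProd (α : ℝ) (N : ℕ) :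
    (1 - α) * ∑ j ∈ Finset.range N, tailProd α j = N * tailProd α N := by
  induction N with
  | zero => simp
  | succ N ih =>
    rw [Finset.sum_range_succ, mul_add, ih, tailProd_succ]
    push_cast
    field_simp
    ring

lemma tailProd_le_rpow {α : ℝ} (h0 : 0 ≤ α) (h1 : α ≤ 1) (N : ℕ) :
    tailProd α N ≤ ((N : ℝ) + 1) ^ (-α) := by
  have hlog : Real.log ((N : ℝ) + 1) ≤ ∑ j ∈ Finset.range N, ((j : ℝ) + 1)⁻¹ := by
    simpa [harmonic] using log_add_one_le_harmonic N
  calc tailProd α N ≤ ∏ j ∈ Finset.range N, Real.exp (-(α * ((j : ℝ) + 1)⁻¹)) := by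
        refine Finset.prod_le_prod (fun j _ => sub_nonneg.2 ?_) fun j _ => ?_
        · exact div_le_one_of_le₀ (h1.trans (by simp)) (by positivity)
        · simpa [div_eq_mul_inv] using Real.one_sub_le_exp_neg (α * ((j : ℝ) + 1)⁻¹)
    _ = Real.exp (-(α * ∑ j ∈ Finset.range N, ((j : ℝ) + 1)⁻¹)) := by
        rw [← Real.exp_sum, Finset.mul_sum, Finset.sum_neg_distrib]
    _ ≤ Real.exp (-(α * Real.log ((N : ℝ) + 1))) := by gcongr
    _ = ((N : ℝ) + 1) ^ (-α) := by
        rw [Real.rpow_def_of_pos (by positivity)]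
        ring_nf

lemma tendsto_tailProd {α : ℝ} (h0 : 0 < α) (h1 : α ≤ 1) :
    Tendsto (tailProd α) atTop (𝓝 0) := by
  refine squeeze_zero (tailProd_nonneg h1) (tailProd_le_rpow h0.le h1) ?_
  exact (tendsto_rpow_neg_atTop h0).comp
    (tendsto_atTop_add_const_right _ _ tendsto_natCast_atTop_atTop)

lemma isProb_A {α : ℝ} (h0 : 0 < α) (h1 : α ≤ 1) : IsProb (A α) := by
  refine ⟨A_nonneg h0.le h1, ?_⟩
  rw [hasSum_iff_tendsto_nat_of_nonneg (A_nonneg h0.le h1), ← tendsto_add_atTop_iff_nat 1]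
  simpa [sum_range_succ_A] using (tendsto_tailProd h0 h1).const_sub 1

lemma A_succ_eq_choose (α : ℝ) (k : ℕ) : A α (k + 1) = (-1) ^ k * Ring.choose α (k + 1) := by
  have hprod : α * ∏ j ∈ Finset.Ico 1 (k + 1), ((j : ℝ) - α) =
      (-1) ^ k * (descPochhammer ℝ (k + 1)).eval α := by
    have hneg : ∏ j ∈ Finset.Ico 1 (k + 1), ((j : ℝ) - α) =
        (-1) ^ k * ∏ j ∈ Finset.Ico 1 (k + 1), (α - j) := by
      simp_rw [← neg_sub α, Finset.prod_neg]
      simp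
    rw [descPochhammer_eval_eq_prod_range, Finset.prod_range_eq_mul_Ico _ k.succ_pos, hneg]
    push_cast
    ring
  have hchoose : ((k + 1).factorial : ℝ) * Ring.choose α (k + 1) =
      (descPochhammer ℝ (k + 1)).eval α := by
    rw [← nsmul_eq_mul, ← Ring.descPochhammer_eq_factorial_smul_choose,
      ← Polynomial.aeval_eq_smeval, ← descPochhammer_map (Int.castRingHom ℝ), Polynomial.eval_map,
      Polynomial.aeval_def, algebraMap_int_eq]
  rw [A, if_neg k.succ_ne_zero, hprod, ← hchoose]
  field_simp

/-- The generating function `∑_k F(k) z^k`, which gives `F̂(ξ)` at `z = e^{-iξ}`. -/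
noncomputable def pgf (F : ℕ → ℝ) (z : ℂ) : ℂ := ∑' k : ℕ, (F k : ℂ) * z ^ k

lemma norm_mul_pow_le (F : ℕ → ℝ) {z : ℂ} (hz : ‖z‖ ≤ 1) (k : ℕ) :
    ‖(F k : ℂ) * z ^ k‖ ≤ |F k| := by
  rw [norm_mul, norm_pow, Complex.norm_real, Real.norm_eq_abs]
  exact mul_le_of_le_one_right (abs_nonneg _) (pow_le_one₀ (norm_nonneg _) hz)

lemma summable_norm_mul_pow {F : ℕ → ℝ} (hF : Summable F) {z : ℂ} (hz : ‖z‖ ≤ 1) :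
    Summable fun k => ‖(F k : ℂ) * z ^ k‖ :=
  hF.abs.of_nonneg_of_le (fun _ => norm_nonneg _) (norm_mul_pow_le F hz)

lemma hasSum_pgf {F : ℕ → ℝ} (hF : Summable F) {z : ℂ} (hz : ‖z‖ ≤ 1) :
    HasSum (fun k => (F k : ℂ) * z ^ k) (pgf F z) :=
  (summable_norm_mul_pow hF hz).of_norm.hasSum

lemma pgf_sub {F G : ℕ → ℝ} (hF : Summable F) (hG : Summable G) {z : ℂ} (hz : ‖z‖ ≤ 1) :
    pgf (F - G) z = pgf F z - pgf G z := by
  rw [← ((hasSum_pgf hF hz).sub (hasSum_pgf hG hz)).tsum_eq, pgf]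
  simp only [Pi.sub_apply, Complex.ofReal_sub, sub_mul]

lemma continuousOn_pgf {F : ℕ → ℝ} (hF : Summable F) :
    ContinuousOn (pgf F) (Metric.closedBall 0 1) :=
  continuousOn_tsum (fun k => by fun_prop) hF.abs
    fun k z hz => norm_mul_pow_le F (by simpa using hz) k

lemma IsProb.pgf_one {F : ℕ → ℝ} (hF : IsProb F) : pgf F 1 = 1 := by
  simpa [pgf] using (Complex.hasSum_ofReal.2 hF.2).tsum_eq

lemma IsProb.norm_pgf_le_one {F : ℕ → ℝ} (hF : IsProb F) {z : ℂ} (hz : ‖z‖ ≤ 1) :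
    ‖pgf F z‖ ≤ 1 :=
  tsum_of_norm_bounded hF.2 fun k =>
    (norm_mul_pow_le F hz k).trans_eq (abs_of_nonneg (hF.1 k))

lemma pgf_A_of_norm_lt_one (α : ℝ) {z : ℂ} (hz : ‖z‖ < 1) :
    pgf (A α) z = 1 - (1 - z) ^ (α : ℂ) := by
  have hbinom : HasSum (fun n : ℕ => Ring.choose (α : ℂ) n * (-z) ^ n)
      ((1 - z) ^ (α : ℂ)) := by
    have h := (Complex.one_add_cpow_hasFPowerSeriesOnBall_zero (a := (α : ℂ))).hasSum
      (y := -z) (by simpa [Metric.mem_eball, edist_zero_right, ← ofReal_norm] using hz)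
    simpa [sub_eq_add_neg, List.ofFn_const, binomialSeries_apply,
      -FormalMultilinearSeries.apply_eq_prod_smul_coeff] using h
  rw [pgf, ← ((hasSum_ite_eq 0 (1 : ℂ)).sub hbinom).tsum_eq]
  congr 1 with k
  cases k with
  | zero => simp [A_zero]
  | succ k =>
    rw [A_succ_eq_choose]
    push_cast
    simp only [neg_pow z]
    ring

lemma one_sub_re_nonneg {z : ℂ} (hz : ‖z‖ ≤ 1) : 0 ≤ (1 - z).re := by
  simpa using (Complex.re_le_norm z).trans hz

lemma pgf_A {α : ℝ} (h0 : 0 < α) (h1 : α ≤ 1) {z : ℂ} (hz : ‖z‖ ≤ 1) :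
    pgf (A α) z = 1 - (1 - z) ^ (α : ℂ) := by
  have hcpow : ContinuousOn (fun z : ℂ => 1 - (1 - z) ^ (α : ℂ)) (Metric.closedBall 0 1) := by
    intro w hw
    refine ContinuousAt.continuousWithinAt ?_
    exact continuousAt_const.sub ((Complex.continuousAt_cpow_const_of_re_pos
      (Or.inl (one_sub_re_nonneg (by simpa using hw))) (by simpa using h0)).comp
      (f := fun z : ℂ => 1 - z) (by fun_prop))
  refine Set.EqOn.of_subset_closure (s := Metric.ball 0 1)
    (fun w hw => pgf_A_of_norm_lt_one α (by simpa using hw))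
    (continuousOn_pgf (isProb_A h0 h1).2.summable) hcpow Metric.ball_subset_closedBall ?_
    (by simpa using hz)
  exact (closure_ball (0 : ℂ) one_ne_zero).ge

lemma rpow_cos_le_cos_mul {β φ : ℝ} (h0 : 0 ≤ β) (h1 : β ≤ 1) (hφ : |φ| ≤ Real.pi / 2) :
    Real.cos φ ^ β ≤ Real.cos (φ * β) := by
  have hφ' := abs_le.1 hφ
  have hamgm := Real.geom_mean_le_arith_mean2_weighted h0 (sub_nonneg.2 h1)
    (Real.cos_nonneg_of_mem_Icc hφ') zero_le_one (by ring)
  rw [Real.one_rpow, mul_one] at hamgm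
  have hconcave := strictConcaveOn_cos_Icc.concaveOn.2 (x := φ) (y := 0) hφ'
    (by constructor <;> linarith [Real.pi_pos]) h0 (sub_nonneg.2 h1) (by ring)
  exact hamgm.trans (by simpa [mul_comm] using hconcave)

lemma one_sub_mul_norm_rpow_le_re_cpow {u : ℂ} {β : ℝ} (hu : 0 ≤ u.re) (h0 : 0 ≤ β)
    (h1 : β ≤ 1) : (1 - β) * ‖u‖ ^ β ≤ (u ^ (β : ℂ)).re := by
  have harg : |u.arg| ≤ Real.pi / 2 := Complex.abs_arg_le_pi_div_two_iff.2 hu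
  have hle : |u.arg * β| ≤ β * (Real.pi / 2) := by
    rw [abs_mul, abs_of_nonneg h0, mul_comm]
    gcongr
  have hcos := Real.one_sub_mul_le_cos (abs_nonneg (u.arg * β))
    (hle.trans (by nlinarith [Real.pi_pos]))
  rw [Real.cos_abs] at hcos
  have hlin : 2 / Real.pi * |u.arg * β| ≤ β := by
    calc 2 / Real.pi * |u.arg * β| ≤ 2 / Real.pi * (β * (Real.pi / 2)) := by gcongr
      _ = β := by field_simp
  rw [Complex.cpow_ofReal_re, mul_comm]
  gcongr
  linarith

lemma norm_le_two_mul_cos_arg {u : ℂ} (hu : ‖1 - u‖ ≤ 1) : ‖u‖ ≤ 2 * Real.cos u.arg := by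
  rcases eq_or_ne u 0 with rfl | hu0
  · simp
  have hsq : ‖1 - u‖ ^ 2 = 1 - 2 * (‖u‖ * Real.cos u.arg) + ‖u‖ ^ 2 := by
    rw [Complex.norm_mul_cos_arg, Complex.sq_norm, Complex.sq_norm, Complex.normSq_sub]
    simp
    ring
  have hle : ‖1 - u‖ ^ 2 ≤ 1 := pow_le_one₀ (norm_nonneg _) hu
  nlinarith [norm_pos_iff.2 hu0]

lemma norm_sq_cpow_le {u : ℂ} {β : ℝ} (hu : ‖1 - u‖ ≤ 1) (h0 : 0 ≤ β) (h1 : β ≤ 1) :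
    ‖u ^ (β : ℂ)‖ ^ 2 ≤ 2 ^ β * (u ^ (β : ℂ)).re := by
  have hnorm := norm_le_two_mul_cos_arg hu
  have hcos : 0 ≤ Real.cos u.arg := by linarith [norm_nonneg u]
  have harg : |u.arg| ≤ Real.pi / 2 :=
    Complex.abs_arg_le_pi_div_two_iff.2 (by rw [← Complex.norm_mul_cos_arg]; positivity)
  have hrpow : ‖u‖ ^ β ≤ 2 ^ β * Real.cos (u.arg * β) := by
    calc ‖u‖ ^ β ≤ (2 * Real.cos u.arg) ^ β := by gcongr
      _ = 2 ^ β * Real.cos u.arg ^ β := Real.mul_rpow zero_le_two hcos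
      _ ≤ 2 ^ β * Real.cos (u.arg * β) := by gcongr; exact rpow_cos_le_cos_mul h0 h1 harg
  rw [Complex.norm_cpow_real, Complex.cpow_ofReal_re, sq, mul_left_comm]
  gcongr

lemma norm_one_sub_cpow_le_exp {u : ℂ} {β : ℝ} (hu : ‖1 - u‖ ≤ 1) (h0 : 0 ≤ β) (h1 : β ≤ 1) :
    ‖1 - u ^ (β : ℂ)‖ ≤ Real.exp (-((1 - β) ^ 2 / 2 * ‖u‖ ^ β)) := by
  have htwo : (2 : ℝ) ^ β ≤ 1 + β := by
    simpa [one_add_one_eq_two] using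
      rpow_one_add_le_one_add_mul_self (s := 1) (by norm_num) h0 h1
  have hure : 0 ≤ u.re := by simpa using one_sub_re_nonneg hu
  have hre := one_sub_mul_norm_rpow_le_re_cpow hure h0 h1
  have hre0 : 0 ≤ (u ^ (β : ℂ)).re := le_trans (by have := sub_nonneg.2 h1; positivity) hre
  refine le_of_sq_le_sq ?_ (Real.exp_pos _).le
  calc ‖1 - u ^ (β : ℂ)‖ ^ 2 = 1 - 2 * (u ^ (β : ℂ)).re + ‖u ^ (β : ℂ)‖ ^ 2 := by
        rw [Complex.sq_norm, Complex.sq_norm, Complex.normSq_sub]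
        simp
        ring
    _ ≤ 1 - (2 - 2 ^ β) * (u ^ (β : ℂ)).re := by linarith [norm_sq_cpow_le hu h0 h1]
    _ ≤ 1 - (1 - β) * (u ^ (β : ℂ)).re := by nlinarith
    _ ≤ 1 - (1 - β) * ((1 - β) * ‖u‖ ^ β) := by gcongr
    _ = 1 - (1 - β) ^ 2 * ‖u‖ ^ β := by ring
    _ ≤ Real.exp (-((1 - β) ^ 2 * ‖u‖ ^ β)) := Real.one_sub_le_exp_neg _
    _ = Real.exp (-((1 - β) ^ 2 / 2 * ‖u‖ ^ β)) ^ 2 := by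
      rw [← Real.exp_nat_mul]
      congr 1
      push_cast
      ring

lemma norm_exp_neg_I_mul (ξ : ℝ) : ‖Complex.exp (-(Complex.I * ξ))‖ = 1 := by
  simpa using Complex.norm_exp_I_mul_ofReal (-ξ)

lemma norm_one_sub_exp_le (ξ : ℝ) : ‖1 - Complex.exp (-(Complex.I * ξ))‖ ≤ |ξ| := by
  simpa [norm_sub_rev] using Real.norm_exp_I_mul_ofReal_sub_one_le (x := -ξ)

lemma le_norm_one_sub_exp {ξ : ℝ} (hξ : |ξ| ≤ Real.pi) :
    2 / Real.pi * |ξ| ≤ ‖1 - Complex.exp (-(Complex.I * ξ))‖ := by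
  have hnorm : ‖1 - Complex.exp (-(Complex.I * ξ))‖ = 2 * |Real.sin (ξ / 2)| := by
    rw [norm_sub_rev]
    simpa [neg_div] using Complex.norm_exp_I_mul_ofReal_sub_one (-ξ)
  have hsin := Real.mul_abs_le_abs_sin (x := ξ / 2) (by rw [abs_div, abs_two]; linarith)
  rw [abs_div, abs_two] at hsin
  linarith

lemma fourier_eq_pgf (F : ℕ → ℝ) (ξ : ℝ) :
    fourier F ξ = pgf F (Complex.exp (-(Complex.I * ξ))) := by
  unfold fourier pgf
  congr! 3 with k
  rw [← Complex.exp_nat_mul]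
  ring_nf

lemma hasSum_fourier {F : ℕ → ℝ} (hF : Summable F) (ξ : ℝ) :
    HasSum (fun k : ℕ => (F k : ℂ) * Complex.exp (-(Complex.I * k * ξ))) (fourier F ξ) := by
  rw [fourier_eq_pgf]
  convert hasSum_pgf hF (norm_exp_neg_I_mul ξ).le using 3 with k
  rw [← Complex.exp_nat_mul]
  ring_nf

lemma fourier_sub {F G : ℕ → ℝ} (hF : Summable F) (hG : Summable G) (ξ : ℝ) :
    fourier (F - G) ξ = fourier F ξ - fourier G ξ := by
  simp only [fourier_eq_pgf, pgf_sub hF hG (norm_exp_neg_I_mul ξ).le]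

lemma IsProb.fourier_zero {F : ℕ → ℝ} (hF : IsProb F) : fourier F 0 = 1 := by
  simpa [fourier_eq_pgf] using hF.pgf_one

lemma continuous_fourier {F : ℕ → ℝ} (hF : Summable F) : Continuous (fourier F) := by
  simp_rw [funext (fourier_eq_pgf F)]
  exact (continuousOn_pgf hF).comp_continuous (by fun_prop)
    fun ξ => by simpa using (norm_exp_neg_I_mul ξ).le

lemma integral_exp_int_mul (m : ℤ) :
    ∫ ξ in (-Real.pi)..Real.pi, Complex.exp (Complex.I * m * ξ) =
      if m = 0 then (2 * Real.pi : ℂ) else 0 := by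
  split_ifs with h
  · subst h
    simp
    ring
  · have hc : Complex.I * (m : ℂ) ≠ 0 := mul_ne_zero Complex.I_ne_zero (by exact_mod_cast h)
    have hexp : Complex.exp (Complex.I * m * Real.pi) =
        Complex.exp (Complex.I * m * (-Real.pi : ℝ)) :=
      Complex.exp_eq_exp_iff_exists_int.2 ⟨m, by push_cast; ring⟩
    rw [integral_exp_mul_complex hc, hexp, sub_self, zero_div]

lemma integral_fourier_mul_exp {F : ℕ → ℝ} (hF : Summable F) (k : ℕ) :
    ∫ ξ in (-Real.pi)..Real.pi, fourier F ξ * Complex.exp (Complex.I * k * ξ) =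
      2 * Real.pi * F k := by
  have hnorm : ∀ (j : ℕ) (ξ : ℝ),
      ‖(F j : ℂ) * Complex.exp (Complex.I * ((k - j : ℤ) : ℂ) * ξ)‖ = |F j| := fun j ξ => by
    have := Complex.norm_exp_I_mul_ofReal ((k - j) * ξ)
    push_cast [← mul_assoc] at this ⊢
    rw [norm_mul, this, mul_one, Complex.norm_real, Real.norm_eq_abs]
  have hterm : ∀ (j : ℕ) (ξ : ℝ),
      (F j : ℂ) * Complex.exp (-(Complex.I * j * ξ)) * Complex.exp (Complex.I * k * ξ) =
        (F j : ℂ) * Complex.exp (Complex.I * ((k - j : ℤ) : ℂ) * ξ) := fun j ξ => by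
    rw [mul_assoc, ← Complex.exp_add]
    push_cast
    ring_nf
  have hsum := intervalIntegral.hasSum_integral_of_dominated_convergence
    (μ := MeasureTheory.volume) (a := -Real.pi) (b := Real.pi)
    (F := fun (j : ℕ) (ξ : ℝ) => (F j : ℂ) * Complex.exp (Complex.I * ((k - j : ℤ) : ℂ) * ξ))
    (f := fun ξ => fourier F ξ * Complex.exp (Complex.I * k * ξ)) (fun j _ => |F j|)
    (fun j => Continuous.aestronglyMeasurable (by fun_prop))
    (fun j => .of_forall fun ξ _ => (hnorm j ξ).le)
    (.of_forall fun ξ _ => hF.abs) intervalIntegrable_const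
    (.of_forall fun ξ _ => by
      simpa only [hterm] using (hasSum_fourier hF ξ).mul_right (Complex.exp (Complex.I * k * ξ)))
  refine hsum.unique ?_
  simp_rw [intervalIntegral.integral_const_mul, integral_exp_int_mul, sub_eq_zero, Nat.cast_inj,
    mul_ite, mul_zero]
  convert hasSum_ite_eq k (2 * Real.pi * F k : ℂ) using 3 with j <;> grind

lemma two_pi_mul_abs_le_integral_norm_fourier {F : ℕ → ℝ} (hF : Summable F) (k : ℕ) :
    2 * Real.pi * |F k| ≤ ∫ ξ in (-Real.pi)..Real.pi, ‖fourier F ξ‖ := by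
  have hexp : ∀ ξ : ℝ, ‖Complex.exp (Complex.I * k * ξ)‖ = 1 := fun ξ => by
    simpa [mul_assoc] using Complex.norm_exp_I_mul_ofReal (k * ξ)
  have h := intervalIntegral.norm_integral_le_integral_norm (μ := MeasureTheory.volume)
    (f := fun ξ : ℝ => fourier F ξ * Complex.exp (Complex.I * k * ξ))
    (a := -Real.pi) (b := Real.pi) (by linarith [Real.pi_pos])
  simpa only [integral_fourier_mul_exp hF, norm_mul, hexp, mul_one, Complex.norm_real,
    Complex.norm_ofNat, Real.norm_eq_abs, abs_of_pos Real.pi_pos] using h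

lemma powerSeries_mk_injective {R : Type*} [Semiring R] :
    Function.Injective (PowerSeries.mk : (ℕ → R) → PowerSeries R) := fun F G h =>
  funext fun k => by simpa using congrArg (PowerSeries.coeff k) h

lemma mk_conv (F G : ℕ → ℝ) :
    PowerSeries.mk (conv F G) = PowerSeries.mk F * PowerSeries.mk G := by
  ext m
  simp [conv, PowerSeries.coeff_mul]

lemma mk_delta0 : PowerSeries.mk delta0 = 1 := by
  ext m
  simp [delta0, Pi.single_apply, PowerSeries.coeff_one]

lemma mk_convPow (F : ℕ → ℝ) (n : ℕ) :
    PowerSeries.mk (convPow F n) = PowerSeries.mk F ^ n := by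
  induction n with
  | zero => rw [convPow, mk_delta0, pow_zero]
  | succ n ih => rw [convPow, mk_conv, ih, pow_succ']

lemma hasSum_conv {F G : ℕ → ℝ} (hF : Summable F) (hG : Summable G) :
    HasSum (conv F G) ((∑' k, F k) * ∑' k, G k) := by
  have hsum : Summable (conv F G) :=
    (summable_norm_sum_mul_antidiagonal_of_summable_norm (f := F) (g := G) hF.abs hG.abs).of_norm
  rw [tsum_mul_tsum_eq_tsum_sum_antidiagonal_of_summable_norm (f := F) (g := G) hF.abs hG.abs]
  exact hsum.hasSum

lemma pgf_conv {F G : ℕ → ℝ} (hF : Summable F) (hG : Summable G) {z : ℂ} (hz : ‖z‖ ≤ 1) :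
    pgf (conv F G) z = pgf F z * pgf G z := by
  rw [pgf, pgf, pgf, tsum_mul_tsum_eq_tsum_sum_antidiagonal_of_summable_norm
    (summable_norm_mul_pow hF hz) (summable_norm_mul_pow hG hz)]
  congr! 2 with m
  rw [conv, Complex.ofReal_sum, Finset.sum_mul]
  refine Finset.sum_congr rfl fun p hp => ?_
  rw [← Finset.HasAntidiagonal.mem_antidiagonal.1 hp, pow_add]
  push_cast
  ring

lemma isProb_delta0 : IsProb delta0 :=
  ⟨fun k => (Pi.single_nonneg.2 zero_le_one : (0 : ℕ → ℝ) ≤ Pi.single 0 1) k, hasSum_pi_single 0 1⟩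

protected lemma IsProb.conv {F G : ℕ → ℝ} (hF : IsProb F) (hG : IsProb G) : IsProb (conv F G) := by
  refine ⟨fun k => Finset.sum_nonneg fun p _ => mul_nonneg (hF.1 _) (hG.1 _), ?_⟩
  simpa [hF.2.tsum_eq, hG.2.tsum_eq] using hasSum_conv hF.2.summable hG.2.summable

protected lemma IsProb.convPow {F : ℕ → ℝ} (hF : IsProb F) : ∀ n, IsProb (convPow F n)
  | 0 => isProb_delta0
  | n + 1 => hF.conv (hF.convPow n)

lemma pgf_convPow {F : ℕ → ℝ} (hF : IsProb F) (n : ℕ) {z : ℂ} (hz : ‖z‖ ≤ 1) :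
    pgf (convPow F n) z = pgf F z ^ n := by
  induction n with
  | zero =>
    rw [pgf, tsum_eq_single 0 fun k hk => by simp [convPow, delta0, hk]]
    simp [convPow, delta0]
  | succ n ih =>
    rw [convPow, pgf_conv hF.2.summable (hF.convPow n).2.summable hz, ih, pow_succ']

lemma fourier_convPow {F : ℕ → ℝ} (hF : IsProb F) (n : ℕ) (ξ : ℝ) :
    fourier (convPow F n) ξ = fourier F ξ ^ n := by
  simp only [fourier_eq_pgf, pgf_convPow hF n (norm_exp_neg_I_mul ξ).le]

lemma l1Norm_eq_tsum_enorm (F : ℕ → ℝ) : l1Norm F = ∑' k, ‖F k‖ₑ := by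
  simp only [l1Norm, Real.enorm_eq_ofReal_abs]

lemma l1Norm_eq_ofReal {F : ℕ → ℝ} (hF : Summable F) :
    l1Norm F = ENNReal.ofReal (∑' k, |F k|) :=
  (ENNReal.ofReal_tsum_of_nonneg (fun _ => abs_nonneg _) hF.abs).symm

lemma IsProb.l1Norm_eq_one {F : ℕ → ℝ} (hF : IsProb F) : l1Norm F = 1 := by
  simp [l1Norm_eq_ofReal hF.2.summable, abs_of_nonneg (hF.1 _), hF.2.tsum_eq]

/-- The subordinate `∑_k a(k) b⁽ᵏ⁾`; thus `B_β` is the subordinate of `A_β` and `B`. -/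
noncomputable def subordinate (a b : ℕ → ℝ) (m : ℕ) : ℝ := ∑' k : ℕ, a k * convPow b k m

lemma Bsub_eq_subordinate (ε β : ℝ) : Bsub ε β = subordinate (A β) (B ε) := rfl

lemma hasSubst_mk {b : ℕ → ℝ} (hb : b 0 = 0) : PowerSeries.HasSubst (PowerSeries.mk b) :=
  PowerSeries.HasSubst.of_constantCoeff_zero' (by simp [hb])

lemma mk_subordinate (a : ℕ → ℝ) {b : ℕ → ℝ} (hb : b 0 = 0) :
    PowerSeries.mk (subordinate a b) = (PowerSeries.mk a).subst (PowerSeries.mk b) := by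
  have hpow : ∀ k m, PowerSeries.coeff m (PowerSeries.mk b ^ k) = convPow b k m := fun k m => by
    rw [← mk_convPow, PowerSeries.coeff_mk]
  ext m
  have hfin := PowerSeries.coeff_subst_finite' (hasSubst_mk hb) (PowerSeries.mk a) m
  simp only [PowerSeries.coeff_mk, smul_eq_mul, hpow] at hfin
  rw [PowerSeries.coeff_subst' (hasSubst_mk hb), PowerSeries.coeff_mk, subordinate,
    tsum_eq_finsum (L := .unconditional ℕ) hfin]
  simp only [PowerSeries.coeff_mk, smul_eq_mul, hpow]

lemma convPow_subordinate (a : ℕ → ℝ) {b : ℕ → ℝ} (hb : b 0 = 0) (n : ℕ) :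
    convPow (subordinate a b) n = subordinate (convPow a n) b := by
  apply powerSeries_mk_injective
  rw [mk_convPow, mk_subordinate _ hb, mk_subordinate _ hb, mk_convPow,
    PowerSeries.subst_pow (hasSubst_mk hb)]

lemma subordinate_sub (a a' : ℕ → ℝ) {b : ℕ → ℝ} (hb : b 0 = 0) :
    subordinate (a - a') b = subordinate a b - subordinate a' b := by
  have mk_sub (F G : ℕ → ℝ) :
      PowerSeries.mk (F - G) = PowerSeries.mk F - PowerSeries.mk G := by ext; simp
  apply powerSeries_mk_injective
  rw [mk_sub, mk_subordinate _ hb, mk_subordinate _ hb, mk_subordinate _ hb, mk_sub,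
    PowerSeries.subst_sub (hasSubst_mk hb)]

lemma l1Norm_subordinate_le (a : ℕ → ℝ) {b : ℕ → ℝ} (hb : IsProb b) :
    l1Norm (subordinate a b) ≤ l1Norm a := by
  rw [l1Norm_eq_tsum_enorm]
  calc ∑' m, ‖subordinate a b m‖ₑ ≤ ∑' m, ∑' k, ‖a k * convPow b k m‖ₑ :=
        ENNReal.tsum_le_tsum fun m => enorm_tsum_le_tsum_enorm
    _ = ∑' k, ∑' m, ‖a k‖ₑ * ‖convPow b k m‖ₑ := by
        rw [ENNReal.tsum_comm]
        simp_rw [enorm_mul]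
    _ = ∑' k, ‖a k‖ₑ * l1Norm (convPow b k) := by
        simp_rw [ENNReal.tsum_mul_left, l1Norm_eq_tsum_enorm]
    _ = l1Norm a := by
        simp_rw [(hb.convPow _).l1Norm_eq_one, mul_one, l1Norm_eq_tsum_enorm]

lemma summable_mul_convPow {a b : ℕ → ℝ} (ha : Summable a) (hb : IsProb b) :
    Summable (Function.uncurry fun k m : ℕ => a k * convPow b k m) := by
  have hrow : ∀ k, HasSum (fun m => |a k * convPow b k m|) |a k| := fun k => by
    simpa [abs_mul, abs_of_nonneg ((hb.convPow k).1 _)] using (hb.convPow k).2.mul_left |a k|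
  refine Summable.of_abs ((summable_prod_of_nonneg fun _ => abs_nonneg _).2 ⟨?_, ?_⟩)
  · exact fun k => (hrow k).summable
  · simpa only [Function.uncurry_apply_pair, (hrow _).tsum_eq] using ha.abs

protected lemma IsProb.subordinate {a b : ℕ → ℝ} (ha : IsProb a) (hb : IsProb b) :
    IsProb (subordinate a b) := by
  have hs := summable_mul_convPow ha.2.summable hb
  refine ⟨fun m => tsum_nonneg fun k => mul_nonneg (ha.1 _) ((hb.convPow _).1 _), ?_⟩
  have hsum : ∑' m, subordinate a b m = 1 := by
    simp only [subordinate]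
    rw [hs.tsum_comm]
    simp_rw [tsum_mul_left, (hb.convPow _).2.tsum_eq, mul_one, ha.2.tsum_eq]
  exact hsum ▸ (show Summable (subordinate a b) from hs.prod_symm.prod).hasSum

lemma pgf_subordinate {a b : ℕ → ℝ} (ha : Summable a) (hb : IsProb b) {z : ℂ} (hz : ‖z‖ ≤ 1) :
    pgf (subordinate a b) z = pgf a (pgf b z) := by
  have hs : Summable (Function.uncurry fun k m : ℕ =>
      ((a k * convPow b k m : ℝ) : ℂ) * z ^ m) := by
    refine .of_norm_bounded (summable_mul_convPow ha hb).abs fun p => ?_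
    exact norm_mul_pow_le (fun m => a p.1 * convPow b p.1 m) hz p.2
  simp only [pgf, subordinate, Complex.ofReal_tsum]
  simp_rw [← tsum_mul_right]
  rw [hs.tsum_comm]
  congr! 2 with k
  change _ = (a k : ℂ) * pgf b z ^ k
  simp_rw [← pgf_convPow hb k hz, pgf, ← tsum_mul_left, Complex.ofReal_mul, mul_assoc]

lemma subordinate_mem_classA {a b : ℕ → ℝ} (ha : a ∈ classA) (hb : IsProb b) (hb0 : b 0 = 0) :
    subordinate a b ∈ classA := by
  refine ⟨ha.1.subordinate hb, lt_of_le_of_lt ?_ ha.2⟩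
  gcongr with n
  rw [convPow_subordinate _ hb0, convPow_subordinate _ hb0, ← subordinate_sub _ _ hb0]
  exact l1Norm_subordinate_le _ hb

/-- The difference `F⁽ⁿ⁾ - F⁽ⁿ⁺¹⁾` of consecutive convolution powers. -/
def convStep (F : ℕ → ℝ) (n : ℕ) : ℕ → ℝ := convPow F n - convPow F (n + 1)

/-- The truncated mean `∑_i min(i, N) F(i)`. -/
noncomputable def truncMean (F : ℕ → ℝ) (N : ℕ) : ℝ := ∑' i : ℕ, min (i : ℝ) N * F i

lemma mk_natCast_mul (F : ℕ → ℝ) :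
    PowerSeries.mk (fun j => (j : ℝ) * F j) =
      PowerSeries.X * PowerSeries.derivative ℝ (PowerSeries.mk F) := by
  ext m
  cases m with
  | zero => simp
  | succ m => simp [PowerSeries.coeff_succ_X_mul, PowerSeries.coeff_derivative, mul_comm]

/-- Multiplication by `k` acts on generating functions as the derivation `X d/dX`, which is applied
here to `f^(n+1) - f^(n+2)`. -/
lemma natCast_mul_convStep_succ (F : ℕ → ℝ) (n k : ℕ) :
    (k : ℝ) * convStep F (n + 1) k =
      conv (fun j => j * F j) ((n + 1 : ℝ) • convStep F n - convPow F (n + 1)) k := by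
  suffices h : (fun k : ℕ => (k : ℝ) * convStep F (n + 1) k) =
      conv (fun j => j * F j) ((n + 1 : ℝ) • convStep F n - convPow F (n + 1)) from congrFun h k
  have mk_convStep (n : ℕ) : PowerSeries.mk (convStep F n) =
      PowerSeries.mk F ^ n - PowerSeries.mk F ^ (n + 1) := by
    simp only [← mk_convPow]
    ext
    simp [convStep]
  have mk_smul_sub : PowerSeries.mk ((n + 1 : ℝ) • convStep F n - convPow F (n + 1)) =
      ((n + 1 : ℕ) : PowerSeries ℝ) * PowerSeries.mk (convStep F n) -
        PowerSeries.mk (convPow F (n + 1)) := by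
    ext
    rw [← nsmul_eq_mul]
    simp only [PowerSeries.coeff_mk, map_sub, map_nsmul]
    simp
  apply powerSeries_mk_injective
  rw [mk_natCast_mul, mk_conv, mk_natCast_mul, mk_smul_sub, mk_convStep, mk_convStep, mk_convPow,
    map_sub, PowerSeries.derivative_pow, PowerSeries.derivative_pow]
  push_cast
  ring

lemma IsProb.summable_convStep {F : ℕ → ℝ} (hF : IsProb F) (n : ℕ) : Summable (convStep F n) :=
  (hF.convPow n).2.summable.sub (hF.convPow (n + 1)).2.summable

lemma IsProb.tsum_abs_convStep_le_two {F : ℕ → ℝ} (hF : IsProb F) (n : ℕ) :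
    ∑' k, |convStep F n k| ≤ 2 := by
  have h0 := (hF.convPow n).2
  have h1 := (hF.convPow (n + 1)).2
  calc ∑' k, |convStep F n k| ≤ ∑' k, (convPow F n k + convPow F (n + 1) k) := by
        refine (hF.summable_convStep n).abs.tsum_le_tsum (fun k => ?_) (h0.add h1).summable
        refine (abs_sub _ _).trans_eq ?_
        rw [abs_of_nonneg ((hF.convPow n).1 k), abs_of_nonneg ((hF.convPow (n + 1)).1 k)]
    _ = 2 := by rw [(h0.add h1).tsum_eq, one_add_one_eq_two]

lemma IsProb.min_mul_nonneg {F : ℕ → ℝ} (hF : IsProb F) (N i : ℕ) : 0 ≤ min (i : ℝ) N * F i :=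
  mul_nonneg (by positivity) (hF.1 i)

lemma IsProb.summable_min_mul {F : ℕ → ℝ} (hF : IsProb F) (N : ℕ) :
    Summable fun i : ℕ => min (i : ℝ) N * F i :=
  (hF.2.summable.mul_left (N : ℝ)).of_nonneg_of_le
    (hF.min_mul_nonneg N) fun i => mul_le_mul_of_nonneg_right (min_le_right _ _) (hF.1 i)

lemma IsProb.natCast_mul_abs_convStep_succ_le {F : ℕ → ℝ} (hF : IsProb F) (n : ℕ) {N k : ℕ}
    (hN : 0 < N) (hNk : N ≤ k) :
    N * |convStep F (n + 1) k| ≤ conv (fun i : ℕ => min (i : ℝ) N * F i)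
      (fun i => |((n + 1 : ℝ) • convStep F n - convPow F (n + 1)) i|) k := by
  have hk : (0 : ℝ) < k := by exact_mod_cast hN.trans_le hNk
  have hNk' : (N : ℝ) ≤ k := by exact_mod_cast hNk
  refine le_of_mul_le_mul_left ?_ hk
  rw [mul_left_comm, ← abs_of_pos hk, ← abs_mul, natCast_mul_convStep_succ, abs_of_pos hk]
  simp only [conv, Finset.mul_sum]
  refine (mul_le_mul_of_nonneg_left (Finset.abs_sum_le_sum_abs _ _) N.cast_nonneg).trans ?_
  rw [Finset.mul_sum]
  refine Finset.sum_le_sum fun p hp => ?_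
  have hp1 : (p.1 : ℝ) ≤ k := by
    exact_mod_cast Nat.le.intro (Finset.HasAntidiagonal.mem_antidiagonal.1 hp)
  have hweight : (N : ℝ) * p.1 ≤ k * min (p.1 : ℝ) N := by
    rcases min_cases (p.1 : ℝ) N with ⟨h, _⟩ | ⟨h, _⟩ <;> rw [h]
    · gcongr
    · rw [mul_comm]
      gcongr
  rw [abs_mul, abs_mul, Nat.abs_cast, abs_of_nonneg (hF.1 _), ← mul_assoc, ← mul_assoc,
    ← mul_assoc, ← mul_assoc]
  have := hF.1 p.1
  gcongr

lemma IsProb.natCast_mul_tsum_abs_convStep_succ_le {F : ℕ → ℝ} (hF : IsProb F) (n : ℕ) {N : ℕ}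
    (hN : 0 < N) :
    N * ∑' k, |convStep F (n + 1) (k + N)| ≤
      truncMean F N * ((n + 1) * ∑' k, |convStep F n k| + 1) := by
  set g : ℕ → ℝ := (n + 1 : ℝ) • convStep F n - convPow F (n + 1)
  have hstep : Summable fun k => (n + 1) * |convStep F n k| :=
    (hF.summable_convStep n).abs.mul_left _
  have hpow := (hF.convPow (n + 1)).2
  have hg_le : ∀ k, |g k| ≤ (n + 1) * |convStep F n k| + convPow F (n + 1) k := fun k => by
    refine (abs_sub _ _).trans_eq ?_
    rw [Pi.smul_apply, smul_eq_mul, abs_mul, abs_of_nonneg ((hF.convPow (n + 1)).1 k),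
      abs_of_nonneg (by positivity : (0 : ℝ) ≤ n + 1)]
  have hg : Summable g :=
    ((hstep.add hpow.summable).of_nonneg_of_le (fun _ => abs_nonneg _) hg_le).of_abs
  have hg_tsum : ∑' k, |g k| ≤ (n + 1) * ∑' k, |convStep F n k| + 1 := by
    refine (hg.abs.tsum_le_tsum hg_le (hstep.add hpow.summable)).trans_eq ?_
    rw [hstep.tsum_add hpow.summable, tsum_mul_left, hpow.tsum_eq]
  have hconv := hasSum_conv (hF.summable_min_mul N) hg.abs
  have hconv0 : ∀ k, 0 ≤ conv (fun i : ℕ => min (i : ℝ) N * F i) (fun i => |g i|) k := fun k =>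
    Finset.sum_nonneg fun p _ => mul_nonneg (hF.min_mul_nonneg N _) (abs_nonneg _)
  calc N * ∑' k, |convStep F (n + 1) (k + N)|
      = ∑' k, N * |convStep F (n + 1) (k + N)| := tsum_mul_left.symm
    _ ≤ ∑' k, conv (fun i : ℕ => min (i : ℝ) N * F i) (fun i => |g i|) (k + N) := by
        refine Summable.tsum_le_tsum (fun k => hF.natCast_mul_abs_convStep_succ_le n hN (by omega))
          ?_ ?_
        · exact ((summable_nat_add_iff N).2 (hF.summable_convStep (n + 1)).abs).mul_left _
        · exact (summable_nat_add_iff N).2 hconv.summable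
    _ ≤ ∑' k, conv (fun i : ℕ => min (i : ℝ) N * F i) (fun i => |g i|) k := by
        rw [← hconv.summable.sum_add_tsum_nat_add N]
        exact le_add_of_nonneg_left (Finset.sum_nonneg fun k _ => hconv0 k)
    _ = truncMean F N * ∑' k, |g k| := hconv.tsum_eq
    _ ≤ _ := mul_le_mul_of_nonneg_left hg_tsum (tsum_nonneg (hF.min_mul_nonneg N))

lemma IsProb.natCast_mul_tsum_abs_convStep_le {F : ℕ → ℝ} (hF : IsProb F) {C : ℝ}
    (hC : ∀ n : ℕ, 1 ≤ n → ∃ N : ℕ, 0 < N ∧ n * truncMean F N ≤ N / 4 ∧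
      ∀ k, n * (N * |convStep F n k|) ≤ C) (n : ℕ) :
    n * ∑' k, |convStep F n k| ≤ 4 / 3 * C + 1 := by
  induction n with
  | zero =>
    obtain ⟨N, _, -, hhead⟩ := hC 1 le_rfl
    have hC0 : 0 ≤ C := le_trans (by positivity) (hhead 0)
    simpa using by positivity
  | succ n ih =>
    obtain ⟨N, hN, htrunc, hhead⟩ := hC (n + 1) (by omega)
    have hN' : (0 : ℝ) < N := by exact_mod_cast hN
    have hhead_sum : (n + 1) * ∑ k ∈ Finset.range N, |convStep F (n + 1) k| ≤ C := by
      have hle : ∀ k ∈ Finset.range N, (n + 1) * |convStep F (n + 1) k| ≤ C / N := fun k _ => by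
        rw [le_div_iff₀ hN']
        exact_mod_cast (by ring : _ = _).trans_le (hhead k)
      rw [Finset.mul_sum]
      refine (Finset.sum_le_card_nsmul _ _ _ hle).trans_eq ?_
      rw [Finset.card_range, nsmul_eq_mul, mul_div_cancel₀ _ hN'.ne']
    have htail : (n + 1) * ∑' k, |convStep F (n + 1) (k + N)| ≤
        1 / 4 * (n * ∑' k, |convStep F n k| + 3) := by
      refine le_of_mul_le_mul_left ?_ hN'
      calc N * ((n + 1) * ∑' k, |convStep F (n + 1) (k + N)|)
          = (n + 1) * (N * ∑' k, |convStep F (n + 1) (k + N)|) := by ring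
        _ ≤ (n + 1) * (truncMean F N * ((n + 1) * ∑' k, |convStep F n k| + 1)) := by
            exact mul_le_mul_of_nonneg_left (hF.natCast_mul_tsum_abs_convStep_succ_le n hN)
              (by positivity)
        _ = ((n + 1 : ℕ) * truncMean F N) * ((n + 1) * ∑' k, |convStep F n k| + 1) := by
            push_cast
            ring
        _ ≤ N / 4 * (n * ∑' k, |convStep F n k| + 3) := by
            exact mul_le_mul htrunc (by linarith [hF.tsum_abs_convStep_le_two n]) (by positivity)
              (by positivity)
        _ = N * (1 / 4 * (n * ∑' k, |convStep F n k| + 3)) := by ring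
    rw [← (hF.summable_convStep (n + 1)).abs.sum_add_tsum_nat_add N]
    push_cast
    linarith

lemma IsProb.mem_classA {F : ℕ → ℝ} (hF : IsProb F) {C : ℝ}
    (hC : ∀ n : ℕ, 1 ≤ n → n * ∑' k, |convStep F n k| ≤ C) : F ∈ classA := by
  refine ⟨hF, lt_of_le_of_lt (iSup₂_le fun n hn => ?_) (ENNReal.ofReal_lt_top (r := C))⟩
  rw [← convStep, l1Norm_eq_ofReal (hF.summable_convStep n), ← ENNReal.ofReal_natCast,
    ← ENNReal.ofReal_mul n.cast_nonneg]
  exact ENNReal.ofReal_le_ofReal (hC n hn)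

lemma IsProb.hasSum_min_mul {F : ℕ → ℝ} (hF : IsProb F) (N : ℕ) :
    HasSum (fun i : ℕ => min (i : ℝ) N * F i)
      (∑ j ∈ Finset.range N, (1 - ∑ i ∈ Finset.range (j + 1), F i)) := by
  induction N with
  | zero => simp
  | succ N ih =>
    have hhead : HasSum (fun i => if i ∈ Finset.range (N + 1) then F i else 0)
        (∑ i ∈ Finset.range (N + 1), F i) := by
      rw [← Finset.sum_extend_by_zero (Finset.range (N + 1)) F]
      exact hasSum_sum_of_ne_finset_zero fun i hi => if_neg hi
    rw [Finset.sum_range_succ]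
    convert ih.add (hF.2.sub hhead) using 2 with i
    rcases le_or_gt i N with h | h
    · have h' : (i : ℝ) ≤ N := by exact_mod_cast h
      rw [if_pos (Finset.mem_range.2 (by omega)), min_eq_left h', min_eq_left]
      · ring
      · push_cast
        linarith
    · have h' : (N : ℝ) + 1 ≤ i := by exact_mod_cast h
      rw [if_neg (by simpa using h), Nat.cast_succ, min_eq_right h', min_eq_right (by linarith)]
      ring

lemma truncMean_A {α : ℝ} (h0 : 0 < α) (h1 : α ≤ 1) (N : ℕ) :
    (1 - α) * truncMean (A α) N = N * tailProd α N := by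
  rw [truncMean, ((isProb_A h0 h1).hasSum_min_mul N).tsum_eq, ← sum_range_tailProd]
  simp only [sum_range_succ_A, sub_sub_cancel]

/-- A rate `b` with `|Â_β(ξ)| ≤ exp (-b |ξ|^β)` on `[-π, π]`. -/
noncomputable def decayRate (β : ℝ) : ℝ := (1 - β) ^ 2 / 2 * (2 / Real.pi) ^ β

lemma decayRate_pos {β : ℝ} (h1 : β < 1) : 0 < decayRate β := by
  have : 0 < 1 - β := sub_pos.2 h1
  have := Real.pi_pos
  unfold decayRate
  positivity

lemma norm_fourier_A_le {β : ℝ} (h0 : 0 < β) (h1 : β ≤ 1) {ξ : ℝ} (hξ : |ξ| ≤ Real.pi) :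
    ‖fourier (A β) ξ‖ ≤ Real.exp (-(decayRate β * |ξ| ^ β)) := by
  have hz := (norm_exp_neg_I_mul ξ).le
  rw [fourier_eq_pgf, pgf_A h0 h1 hz]
  refine (norm_one_sub_cpow_le_exp (by simpa using hz) h0.le h1).trans ?_
  rw [Real.exp_le_exp, neg_le_neg_iff, decayRate, mul_assoc,
    ← Real.mul_rpow (by positivity) (abs_nonneg ξ)]
  gcongr
  exact le_norm_one_sub_exp hξ

lemma norm_one_sub_fourier_A_le {β : ℝ} (h0 : 0 < β) (h1 : β ≤ 1) (ξ : ℝ) :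
    ‖1 - fourier (A β) ξ‖ ≤ |ξ| ^ β := by
  have hz := (norm_exp_neg_I_mul ξ).le
  rw [fourier_eq_pgf, pgf_A h0 h1 hz, sub_sub_cancel, Complex.norm_cpow_real]
  gcongr
  exact norm_one_sub_exp_le ξ

lemma IsProb.fourier_convStep {F : ℕ → ℝ} (hF : IsProb F) (n : ℕ) (ξ : ℝ) :
    fourier (convStep F n) ξ = (1 - fourier F ξ) * fourier F ξ ^ n := by
  rw [convStep, fourier_sub (hF.convPow n).2.summable (hF.convPow (n + 1)).2.summable,
    fourier_convPow hF, fourier_convPow hF]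
  ring

lemma norm_fourier_convStep_A_le {β : ℝ} (h0 : 0 < β) (h1 : β ≤ 1) (n : ℕ) {ξ : ℝ}
    (hξ : |ξ| ≤ Real.pi) :
    ‖fourier (convStep (A β) n) ξ‖ ≤
      |ξ| ^ β * Real.exp (-(n * decayRate β) * |ξ| ^ β) := by
  rw [(isProb_A h0 h1).fourier_convStep, norm_mul, norm_pow]
  refine mul_le_mul (norm_one_sub_fourier_A_le h0 h1 ξ) ?_ (by positivity) (by positivity)
  refine (pow_le_pow_left₀ (norm_nonneg _) (norm_fourier_A_le h0 h1 hξ) n).trans_eq ?_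
  rw [← Real.exp_nat_mul]
  ring_nf

lemma integral_abs_rpow_mul_exp {β b : ℝ} (hβ : 0 < β) (hb : 0 < b) :
    ∫ ξ : ℝ, |ξ| ^ β * Real.exp (-b * |ξ| ^ β) =
      2 * (b ^ (-(β + 1) / β) * (1 / β) * Real.Gamma ((β + 1) / β)) := by
  rw [integral_comp_abs (f := fun x : ℝ => x ^ β * Real.exp (-b * x ^ β)),
    integral_rpow_mul_exp_neg_mul_rpow hβ (by linarith) hb]

lemma integrable_abs_rpow_mul_exp {β b : ℝ} (hβ : 0 < β) (hb : 0 < b) :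
    MeasureTheory.Integrable fun ξ : ℝ => |ξ| ^ β * Real.exp (-b * |ξ| ^ β) := by
  refine MeasureTheory.Integrable.of_integral_ne_zero ?_
  rw [integral_abs_rpow_mul_exp hβ hb]
  have := Real.Gamma_pos_of_pos (show 0 < (β + 1) / β by positivity)
  positivity

lemma exists_abs_convStep_A_le {β : ℝ} (h0 : 0 < β) (h1 : β < 1) :
    ∃ C : ℝ, 0 ≤ C ∧ ∀ n : ℕ, 1 ≤ n → ∀ k : ℕ,
      |convStep (A β) n k| ≤ C * (n : ℝ) ^ (-(β + 1) / β) := by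
  have hb := decayRate_pos h1
  have := Real.Gamma_pos_of_pos (show 0 < (β + 1) / β by positivity)
  refine ⟨(2 * Real.pi)⁻¹ * (2 * (decayRate β ^ (-(β + 1) / β) * (1 / β) *
    Real.Gamma ((β + 1) / β))), by positivity, fun n hn k => ?_⟩
  have hn0 : (0 : ℝ) < n := by exact_mod_cast hn
  have hsum := (isProb_A h0 h1.le).summable_convStep n
  have hint := integrable_abs_rpow_mul_exp h0 (mul_pos hn0 hb)
  have hle : 2 * Real.pi * |convStep (A β) n k| ≤
      ∫ ξ : ℝ, |ξ| ^ β * Real.exp (-(n * decayRate β) * |ξ| ^ β) :=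
    calc 2 * Real.pi * |convStep (A β) n k|
        ≤ ∫ ξ in (-Real.pi)..Real.pi, ‖fourier (convStep (A β) n) ξ‖ :=
          two_pi_mul_abs_le_integral_norm_fourier hsum k
      _ ≤ ∫ ξ in Set.Ioc (-Real.pi) Real.pi,
            |ξ| ^ β * Real.exp (-(n * decayRate β) * |ξ| ^ β) := by
          rw [intervalIntegral.integral_of_le (by linarith [Real.pi_pos])]
          exact MeasureTheory.setIntegral_mono_on (continuous_fourier hsum).norm.integrableOn_Ioc
            hint.integrableOn measurableSet_Ioc
            fun ξ hξ => norm_fourier_convStep_A_le h0 h1.le n (abs_le.2 ⟨hξ.1.le, hξ.2⟩)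
      _ ≤ _ := MeasureTheory.setIntegral_le_integral hint
          (Eventually.of_forall fun ξ => by positivity)
  rw [integral_abs_rpow_mul_exp h0 (mul_pos hn0 hb), Real.mul_rpow hn0.le hb.le,
    ← le_div_iff₀' (by positivity)] at hle
  refine hle.trans_eq ?_
  ring

lemma mul_truncMean_A_le {β x : ℝ} (h0 : 0 < β) (h1 : β ≤ 1) (hx : 0 < x) {N : ℕ}
    (hN : x ^ (1 / β) ≤ N) : (1 - β) * (x * truncMean (A β) N) ≤ N := by
  have htail : tailProd β N ≤ x⁻¹ :=
    calc tailProd β N ≤ ((N : ℝ) + 1) ^ (-β) := tailProd_le_rpow h0.le h1 N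
      _ ≤ (x ^ (1 / β)) ^ (-β) :=
          Real.rpow_le_rpow_of_nonpos (by positivity) (by linarith) (by linarith)
      _ = x⁻¹ := by
          rw [← Real.rpow_mul hx.le, ← Real.rpow_neg_one]
          congr 1
          field_simp
  calc (1 - β) * (x * truncMean (A β) N) = x * N * tailProd β N := by
        rw [mul_left_comm, truncMean_A h0 h1, mul_assoc]
    _ ≤ x * N * x⁻¹ := by gcongr
    _ = N := by field_simp

lemma mul_rpow_mul_rpow_neg {β c x : ℝ} (hβ : β ≠ 0) (hc : 0 ≤ c) (hx : 0 < x) :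
    x * ((c * x) ^ (1 / β) * x ^ (-(β + 1) / β)) = c ^ (1 / β) := by
  have hexp : 1 + (1 / β + -(β + 1) / β) = 0 := by
    field_simp
    ring
  calc x * ((c * x) ^ (1 / β) * x ^ (-(β + 1) / β))
      = c ^ (1 / β) * (x ^ (1 : ℝ) * (x ^ (1 / β) * x ^ (-(β + 1) / β))) := by
        rw [Real.mul_rpow hc hx.le, Real.rpow_one]
        ring
    _ = c ^ (1 / β) := by
        rw [← Real.rpow_add hx, ← Real.rpow_add hx, hexp, Real.rpow_zero, mul_one]

theorem A_mem_classA {β : ℝ} (h0 : 0 < β) (h1 : β < 1) : A β ∈ classA := by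
  obtain ⟨C, _, hC⟩ := exists_abs_convStep_A_le h0 h1
  have hβ : 0 < 1 - β := sub_pos.2 h1
  set c : ℝ := 4 / (1 - β)
  have hc : 1 ≤ c := (one_le_div hβ).2 (by linarith)
  refine (isProb_A h0 h1.le).mem_classA fun n _ =>
    (isProb_A h0 h1.le).natCast_mul_tsum_abs_convStep_le (C := 2 * C * c ^ (1 / β))
      (fun n hn => ⟨⌈(c * n) ^ (1 / β)⌉₊, ?_⟩) n
  have hn1 : (1 : ℝ) ≤ n := by exact_mod_cast hn
  set N := ⌈(c * n) ^ (1 / β)⌉₊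
  have hone : 1 ≤ (c * n) ^ (1 / β) :=
    Real.one_le_rpow (one_le_mul_of_one_le_of_one_le hc hn1) (by positivity)
  have hN2 : (N : ℝ) ≤ 2 * (c * n) ^ (1 / β) := by
    linarith [Nat.ceil_lt_add_one (zero_le_one.trans hone)]
  refine ⟨Nat.ceil_pos.2 (by positivity), ?_, fun k => ?_⟩
  · have htrunc := mul_truncMean_A_le h0 h1.le (by positivity) (Nat.le_ceil ((c * n) ^ (1 / β)))
    have hcancel : (1 - β) * (c * n * truncMean (A β) N) = 4 * (n * truncMean (A β) N) := by
      simp only [c]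
      field_simp
    linarith
  · calc n * (N * |convStep (A β) n k|)
        ≤ n * (2 * (c * n) ^ (1 / β) * (C * (n : ℝ) ^ (-(β + 1) / β))) := by
          gcongr
          exact hC n hn k
      _ = 2 * C * (n * ((c * n) ^ (1 / β) * (n : ℝ) ^ (-(β + 1) / β))) := by ring
      _ = 2 * C * c ^ (1 / β) := by
          rw [mul_rpow_mul_rpow_neg h0.ne' (by positivity) (by positivity)]

lemma continuous_A (k : ℕ) : Continuous fun α => A α k := by
  unfold A
  split_ifs <;> fun_prop

lemma B_zero (ε : ℝ) : B ε 0 = 0 := by simp [B, A_zero]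

lemma hasSum_B_mul_pow {ε : ℝ} (h0 : 0 ≤ ε) (h1 : ε ≤ 1) {z : ℂ} (hz : ‖z‖ ≤ 1) :
    HasSum (fun k : ℕ => (B ε k : ℂ) * z ^ k)
      ((ε : ℂ)⁻¹ * ∫ α in (0 : ℝ)..ε, (1 - (1 - z) ^ (α : ℂ))) := by
  have hA : ∀ α ∈ Set.uIoc 0 ε, IsProb (A α) ∧ pgf (A α) z = 1 - (1 - z) ^ (α : ℂ) :=
    fun α hα => by
      rw [Set.uIoc_of_le h0] at hα
      exact ⟨isProb_A hα.1 (hα.2.trans h1), pgf_A hα.1 (hα.2.trans h1) hz⟩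
  have hint : HasSum (fun k => ∫ α in (0 : ℝ)..ε, (A α k : ℂ) * z ^ k)
      (∫ α in (0 : ℝ)..ε, (1 - (1 - z) ^ (α : ℂ))) :=
    intervalIntegral.hasSum_integral_of_dominated_convergence (fun k α => |A α k|)
      (fun k => ((Complex.continuous_ofReal.comp (continuous_A k)).mul
        continuous_const).aestronglyMeasurable)
      (fun k => .of_forall fun α _ => norm_mul_pow_le (A α) hz k)
      (.of_forall fun α hα => (hA α hα).1.2.summable.abs)
      ((intervalIntegrable_const (c := (1 : ℝ))).congr fun α hα => by
        simp only [abs_of_nonneg ((hA α hα).1.1 _), (hA α hα).1.2.tsum_eq])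
      (.of_forall fun α hα => (hA α hα).2 ▸ hasSum_pgf (hA α hα).1.2.summable hz)
  have hcoeff : ∀ k, (B ε k : ℂ) * z ^ k =
      (ε : ℂ)⁻¹ * ∫ α in (0 : ℝ)..ε, (A α k : ℂ) * z ^ k := fun k => by
    rw [intervalIntegral.integral_mul_const, intervalIntegral.integral_ofReal, B,
      Complex.ofReal_mul, Complex.ofReal_inv, mul_assoc]
  simpa only [hcoeff] using hint.mul_left (ε : ℂ)⁻¹

theorem isProb_B {ε : ℝ} (h0 : 0 < ε) (h1 : ε ≤ 1) : IsProb (B ε) := by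
  constructor
  · intro k
    exact mul_nonneg (inv_nonneg.2 h0.le) (intervalIntegral.integral_nonneg h0.le
      fun α hα => A_nonneg hα.1 (hα.2.trans h1) k)
  · have hint : ∫ α in (0 : ℝ)..ε, (1 - (1 - (1 : ℂ)) ^ (α : ℂ)) = ε := by
      rw [intervalIntegral.integral_congr_ae (g := fun _ => (1 : ℂ)) (.of_forall fun α hα => ?_)]
      · simp
      · rw [Set.uIoc_of_le h0.le] at hα
        rw [sub_self, Complex.zero_cpow (by exact_mod_cast hα.1.ne'), sub_zero]
    have hone := hasSum_B_mul_pow h0.le h1 (z := 1) (by simp)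
    rw [hint, inv_mul_cancel₀ (by exact_mod_cast h0.ne')] at hone
    rw [← Complex.hasSum_ofReal]
    simpa using hone

lemma one_sub_pgf_B {ε : ℝ} (h0 : 0 < ε) (h1 : ε ≤ 1) {z : ℂ} (hz : ‖z‖ ≤ 1) (hz1 : z ≠ 1) :
    1 - pgf (B ε) z = (ε : ℂ)⁻¹ * ∫ α in (0 : ℝ)..ε, (1 - z) ^ (α : ℂ) := by
  have hcont : Continuous fun α : ℝ => (1 - z) ^ (α : ℂ) :=
    Complex.continuous_ofReal.const_cpow (Or.inl (sub_ne_zero.2 hz1.symm))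
  have hε : (ε : ℂ) ≠ 0 := by exact_mod_cast h0.ne'
  rw [pgf, (hasSum_B_mul_pow h0.le h1 hz).tsum_eq, intervalIntegral.integral_sub
    intervalIntegrable_const (hcont.intervalIntegrable _ _), intervalIntegral.integral_const,
    sub_zero, Complex.real_smul, mul_one, mul_sub, inv_mul_cancel₀ hε, sub_sub_cancel]

lemma le_re_one_sub_pgf_B {ε δ : ℝ} (h0 : 0 < ε) (h1 : ε ≤ 1) (hδ : 0 ≤ δ) (hδε : δ ≤ ε) {z : ℂ}
    (hz : ‖z‖ ≤ 1) (hz1 : z ≠ 1) (hz2 : ‖1 - z‖ ≤ 1) :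
    ε⁻¹ * (δ * ((1 - δ) * ‖1 - z‖ ^ δ)) ≤ (1 - pgf (B ε) z).re := by
  have hcont : Continuous fun α : ℝ => (1 - z) ^ (α : ℂ) :=
    Complex.continuous_ofReal.const_cpow (Or.inl (sub_ne_zero.2 hz1.symm))
  have hre : Continuous fun α : ℝ => ((1 - z) ^ (α : ℂ)).re := Complex.continuous_re.comp hcont
  have hle : ∀ α ∈ Set.Icc 0 ε, (1 - α) * ‖1 - z‖ ^ α ≤ ((1 - z) ^ (α : ℂ)).re := fun α hα =>
    one_sub_mul_norm_rpow_le_re_cpow (one_sub_re_nonneg hz) hα.1 (hα.2.trans h1)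
  have hlow : ∀ α ∈ Set.Icc 0 δ, (1 - δ) * ‖1 - z‖ ^ δ ≤ ((1 - z) ^ (α : ℂ)).re := fun α hα => by
    refine le_trans ?_ (hle α ⟨hα.1, hα.2.trans hδε⟩)
    have : 0 ≤ 1 - α := by linarith [hα.2]
    refine mul_le_mul (by linarith [hα.2]) ?_ (by positivity) this
    exact Real.rpow_le_rpow_of_exponent_ge (norm_pos_iff.2 (sub_ne_zero.2 hz1.symm)) hz2 hα.2
  have hhigh : 0 ≤ ∫ α in δ..ε, ((1 - z) ^ (α : ℂ)).re :=
    intervalIntegral.integral_nonneg hδε fun α hα =>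
      le_trans (mul_nonneg (by linarith [hα.2]) (by positivity)) (hle α ⟨hδ.trans hα.1, hα.2⟩)
  calc ε⁻¹ * (δ * ((1 - δ) * ‖1 - z‖ ^ δ))
      = ε⁻¹ * ∫ _ in (0 : ℝ)..δ, (1 - δ) * ‖1 - z‖ ^ δ := by
        rw [intervalIntegral.integral_const, sub_zero, smul_eq_mul]
    _ ≤ ε⁻¹ * ∫ α in (0 : ℝ)..δ, ((1 - z) ^ (α : ℂ)).re := by
        gcongr
        exact intervalIntegral.integral_mono_on hδ intervalIntegrable_const
          (hre.intervalIntegrable 0 δ) hlow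
    _ ≤ ε⁻¹ * ∫ α in (0 : ℝ)..ε, ((1 - z) ^ (α : ℂ)).re := by
        gcongr
        rw [← intervalIntegral.integral_add_adjacent_intervals (hre.intervalIntegrable 0 δ)
          (hre.intervalIntegrable δ ε)]
        exact le_add_of_nonneg_right hhigh
    _ = (1 - pgf (B ε) z).re := by
        rw [one_sub_pgf_B h0 h1 hz hz1, ← Complex.ofReal_inv, Complex.re_ofReal_mul]
        exact congrArg _ (Complex.reCLM.intervalIntegral_comp_comm (hcont.intervalIntegrable _ _))

lemma one_sub_fourier_subordinate_A {b : ℕ → ℝ} (hb : IsProb b) {β : ℝ} (h0 : 0 < β)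
    (h1 : β ≤ 1) (ξ : ℝ) :
    1 - fourier (subordinate (A β) b) ξ = (1 - fourier b ξ) ^ (β : ℂ) := by
  have hz := (norm_exp_neg_I_mul ξ).le
  rw [fourier_eq_pgf, fourier_eq_pgf, pgf_subordinate (isProb_A h0 h1).2.summable hb hz,
    pgf_A h0 h1 (hb.norm_pgf_le_one hz), sub_sub_cancel]

lemma le_norm_one_sub_fourier_B {ε δ : ℝ} (h0 : 0 < ε) (h1 : ε ≤ 1) (hδ : 0 ≤ δ) (hδε : δ ≤ ε)
    {ξ : ℝ} (hξ0 : ξ ≠ 0) (hξ1 : |ξ| ≤ 1) :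
    ε⁻¹ * (δ * ((1 - δ) * (2 / Real.pi) ^ δ)) * |ξ| ^ δ ≤ ‖1 - fourier (B ε) ξ‖ := by
  have hz := (norm_exp_neg_I_mul ξ).le
  have hge := le_norm_one_sub_exp (hξ1.trans (by linarith [Real.pi_gt_three]))
  have hle := (norm_one_sub_exp_le ξ).trans hξ1
  rw [fourier_eq_pgf]
  set z := Complex.exp (-(Complex.I * ξ))
  have hz1 : z ≠ 1 := by
    rw [ne_comm, ← sub_ne_zero, ← norm_pos_iff]
    exact lt_of_lt_of_le (by positivity) hge
  have hδ1 : 0 ≤ 1 - δ := by linarith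
  calc ε⁻¹ * (δ * ((1 - δ) * (2 / Real.pi) ^ δ)) * |ξ| ^ δ
      = ε⁻¹ * (δ * ((1 - δ) * (2 / Real.pi * |ξ|) ^ δ)) := by
        rw [Real.mul_rpow (by positivity) (abs_nonneg ξ)]
        ring
    _ ≤ ε⁻¹ * (δ * ((1 - δ) * ‖1 - z‖ ^ δ)) := by gcongr
    _ ≤ (1 - pgf (B ε) z).re := le_re_one_sub_pgf_B h0 h1 hδ hδε hz hz1 hle
    _ ≤ ‖1 - pgf (B ε) z‖ := Complex.re_le_norm _

lemma eventually_ne_zero_and_abs_le_one : ∀ᶠ ξ : ℝ in 𝓝[≠] 0, ξ ≠ 0 ∧ |ξ| ≤ 1 := by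
  filter_upwards [self_mem_nhdsWithin,
    nhdsWithin_le_nhds (Metric.closedBall_mem_nhds (0 : ℝ) one_pos)] with ξ hξ hξ1
  exact ⟨hξ, by simpa using hξ1⟩

lemma isBigO_abs_rpow_of_le {γ δ : ℝ} (h : δ ≤ γ) :
    (fun ξ : ℝ => |ξ| ^ γ) =O[𝓝[≠] 0] fun ξ => |ξ| ^ δ := by
  refine .of_bound 1 ?_
  filter_upwards [eventually_ne_zero_and_abs_le_one] with ξ ⟨hξ0, hξ1⟩
  rw [one_mul, Real.norm_of_nonneg (by positivity), Real.norm_of_nonneg (by positivity)]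
  exact Real.rpow_le_rpow_of_exponent_ge (abs_pos.2 hξ0) hξ1 h

lemma isLittleO_abs_rpow_of_lt {γ δ : ℝ} (h : δ < γ) :
    (fun ξ : ℝ => |ξ| ^ γ) =o[𝓝[≠] 0] fun ξ => |ξ| ^ δ := by
  have hlim : Tendsto (fun ξ : ℝ => |ξ| ^ (γ - δ)) (𝓝[≠] 0) (𝓝 0) := by
    have hcont : Continuous fun ξ : ℝ => |ξ| ^ (γ - δ) :=
      continuous_abs.rpow_const fun _ => Or.inr (sub_nonneg.2 h.le)
    simpa [Real.zero_rpow (sub_pos.2 h).ne'] using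
      (hcont.tendsto 0).mono_left nhdsWithin_le_nhds
  refine Asymptotics.isLittleO_of_tendsto' ?_ (hlim.congr' ?_) <;>
    filter_upwards [self_mem_nhdsWithin] with ξ hξ
  · exact fun h0 => absurd h0 (Real.rpow_pos_of_pos (abs_pos.2 hξ) δ).ne'
  · exact Real.rpow_sub (abs_pos.2 hξ) γ δ

lemma isBigO_one_sub_fourier_B {ε δ : ℝ} (h0 : 0 < ε) (h1 : ε ≤ 1) (hδ : 0 < δ) :
    (fun ξ : ℝ => |ξ| ^ δ) =O[𝓝[≠] 0] fun ξ => 1 - fourier (B ε) ξ := by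
  set δ' := min δ (ε / 2)
  have hδ' : 0 < δ' := lt_min hδ (half_pos h0)
  have hδε : δ' ≤ ε / 2 := min_le_right _ _
  have hδ1 : 0 < 1 - δ' := by linarith
  refine (isBigO_abs_rpow_of_le (min_le_left δ (ε / 2))).trans
    (.of_bound (ε⁻¹ * (δ' * ((1 - δ') * (2 / Real.pi) ^ δ')))⁻¹ ?_)
  filter_upwards [eventually_ne_zero_and_abs_le_one] with ξ ⟨hξ0, hξ1⟩
  rw [Real.norm_of_nonneg (by positivity), ← div_eq_inv_mul,
    le_div_iff₀' (by have := Real.pi_pos; positivity)]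
  exact le_norm_one_sub_fourier_B h0 h1 hδ'.le (by linarith) hξ0 hξ1

lemma isBigO_one_sub_fourier_Bsub {ε β γ : ℝ} (hε0 : 0 < ε) (hε1 : ε ≤ 1) (hβ0 : 0 < β)
    (hβ1 : β ≤ 1) (hγ : 0 < γ) :
    (fun ξ : ℝ => |ξ| ^ γ) =O[𝓝[≠] 0] fun ξ => 1 - fourier (Bsub ε β) ξ := by
  have h := ((isBigO_one_sub_fourier_B hε0 hε1 (div_pos hγ hβ0)).norm_right.rpow hβ0.le
    (.of_forall fun ξ => norm_nonneg _))
  refine .of_norm_right (h.congr (fun ξ => ?_) fun ξ => ?_)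
  · rw [← Real.rpow_mul (abs_nonneg ξ), div_mul_cancel₀ _ hβ0.ne']
  · rw [Bsub_eq_subordinate, one_sub_fourier_subordinate_A (isProb_B hε0 hε1) hβ0 hβ1,
      Complex.norm_cpow_real]

lemma eventually_fourier_Bsub_ne_one {ε β : ℝ} (hε0 : 0 < ε) (hε1 : ε ≤ 1) (hβ0 : 0 < β)
    (hβ1 : β ≤ 1) : ∀ᶠ ξ in 𝓝[≠] (0 : ℝ), fourier (Bsub ε β) ξ ≠ 1 := by
  filter_upwards [(isBigO_one_sub_fourier_Bsub hε0 hε1 hβ0 hβ1 one_pos).eq_zero_imp,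
    self_mem_nhdsWithin] with ξ himp hξ hone
  exact hξ (by simpa using himp (sub_eq_zero.2 hone.symm))

lemma isLittleO_one_sub_fourier_Bsub {ε β α : ℝ} (hε0 : 0 < ε) (hε1 : ε ≤ 1) (hβ0 : 0 < β)
    (hβ1 : β ≤ 1) (hα : 0 < α) :
    (fun ξ : ℝ => |ξ| ^ α) =o[𝓝[≠] 0] fun ξ => 1 - fourier (Bsub ε β) ξ :=
  (isLittleO_abs_rpow_of_lt (half_lt_self hα)).trans_isBigO
    (isBigO_one_sub_fourier_Bsub hε0 hε1 hβ0 hβ1 (half_pos hα))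

/-- `F̂` is Hölder continuous of order `α` at `0` from the right, a consequence of each of the
criteria that `B_β` is to violate. -/
def HolderAtZero (α : ℝ) (F : ℕ → ℝ) : Prop :=
  (fun ξ : ℝ => 1 - fourier F ξ) =O[𝓝[>] 0] fun ξ => |ξ| ^ α

lemma HolderAtZero.not_isLittleO {α : ℝ} {F : ℕ → ℝ} (h : HolderAtZero α F) :
    ¬ (fun ξ : ℝ => |ξ| ^ α) =o[𝓝[≠] 0] fun ξ => 1 - fourier F ξ := fun ho => by
  have hirrefl := (ho.mono (nhdsGT_le_nhdsNE 0)).trans_isBigO h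
  refine Asymptotics.isLittleO_irrefl' ?_ hirrefl
  refine Eventually.frequently ?_
  filter_upwards [self_mem_nhdsWithin] with ξ (hξ : 0 < ξ)
  exact norm_ne_zero_iff.2 (Real.rpow_pos_of_pos (abs_pos.2 hξ.ne') α).ne'

lemma DerivBound.holderAtZero {F : ℕ → ℝ} (hF : IsProb F) {α : ℝ} (hα : 0 < α)
    (h : DerivBound α F) : HolderAtZero α F := by
  obtain ⟨c, _, h⟩ := h
  refine .of_bound (c / α) ?_
  filter_upwards [Ioc_mem_nhdsGT Real.pi_pos] with ξ ⟨hξ0, hξπ⟩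
  have hderiv : ∀ x ∈ Set.Ioo 0 ξ,
      DifferentiableAt ℝ (fourier F) x ∧ ‖deriv (fourier F) x‖ ≤ c * x ^ (α - 1) := fun x hx => by
    have hnhds : Set.Icc (-Real.pi) Real.pi ∈ 𝓝 x :=
      Icc_mem_nhds (by linarith [hx.1]) (hx.2.trans_le hξπ)
    obtain ⟨hdiff, hbound⟩ := h x (mem_of_mem_nhds hnhds) hx.1.ne'
    rw [derivWithin_of_mem_nhds hnhds, abs_of_pos hx.1] at hbound
    exact ⟨hdiff.differentiableAt hnhds, hbound⟩
  rw [Real.norm_of_nonneg (by positivity), abs_of_pos hξ0, norm_sub_rev, ← hF.fourier_zero]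
  calc ‖fourier F ξ - fourier F 0‖ ≤ ∫ x in (0 : ℝ)..ξ, c * x ^ (α - 1) :=
        norm_sub_le_integral_of_norm_deriv_le_of_le hξ0.le
          (continuous_fourier hF.2.summable).continuousOn
          (fun x hx => (hderiv x hx).1.differentiableWithinAt)
          (.of_forall fun x hx => (hderiv x hx).2)
          ((intervalIntegral.intervalIntegrable_rpow' (by linarith)).const_mul c)
    _ = c / α * ξ ^ α := by
        rw [intervalIntegral.integral_const_mul, integral_rpow (Or.inl (by linarith)),
          sub_add_cancel, Real.zero_rpow hα.ne', sub_zero]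
        ring

lemma hasSum_one_sub_fourier {F : ℕ → ℝ} (hF : IsProb F) (ξ : ℝ) :
    HasSum (fun k : ℕ => (F k : ℂ) * (1 - Complex.exp (-(Complex.I * (k * ξ : ℝ)))))
      (1 - fourier F ξ) := by
  simpa [mul_sub, mul_assoc] using
    (Complex.hasSum_ofReal.2 hF.2).sub (hasSum_fourier hF.2.summable ξ)

lemma norm_one_sub_fourier_sub_le {F G : ℕ → ℝ} (hF : IsProb F) (hG : IsProb G) {a : ℝ}
    (h : Summable fun k : ℕ => (k : ℝ) * |G k - a * F k|) (ξ : ℝ) :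
    ‖(1 - fourier G ξ) - a * (1 - fourier F ξ)‖ ≤
      (∑' k : ℕ, (k : ℝ) * |G k - a * F k|) * |ξ| := by
  have hsum := (hasSum_one_sub_fourier hG ξ).sub ((hasSum_one_sub_fourier hF ξ).mul_left (a : ℂ))
  rw [← hsum.tsum_eq]
  refine tsum_of_norm_bounded (h.hasSum.mul_right |ξ|) fun k => ?_
  rw [← mul_assoc, ← sub_mul, ← Complex.ofReal_mul, ← Complex.ofReal_sub, norm_mul,
    Complex.norm_real, Real.norm_eq_abs]
  calc |G k - a * F k| * ‖1 - Complex.exp (-(Complex.I * (k * ξ : ℝ)))‖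
      ≤ |G k - a * F k| * |k * ξ| := by
        gcongr
        exact norm_one_sub_exp_le _
    _ = k * |G k - a * F k| * |ξ| := by
        rw [abs_mul, Nat.abs_cast]
        ring

lemma HolderAtZero.of_summable {F G : ℕ → ℝ} (hF : IsProb F) (hG : IsProb G) {α a : ℝ}
    (hα : α ≤ 1) (hs : Summable fun k : ℕ => (k : ℝ) * |G k - a * F k|) (h : HolderAtZero α F) :
    HolderAtZero α G := by
  have hdiff : (fun ξ : ℝ => (1 - fourier G ξ) - a * (1 - fourier F ξ)) =O[𝓝[>] 0]
      fun ξ => |ξ| ^ (1 : ℝ) := by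
    refine .of_bound (∑' k : ℕ, (k : ℝ) * |G k - a * F k|) (.of_forall fun ξ => ?_)
    simpa using norm_one_sub_fourier_sub_le hF hG hs ξ
  have hlin := (isBigO_abs_rpow_of_le hα).mono (nhdsGT_le_nhdsNE 0)
  refine ((hdiff.trans hlin).add (h.const_mul_left (a : ℂ))).congr_left fun ξ => ?_
  exact sub_add_cancel _ _

lemma ComparisonCriterion.holderAtZero {G : ℕ → ℝ} {α : ℝ} (h0 : 0 < α) (h1 : α ≤ 1)
    (h : ComparisonCriterion α G) : HolderAtZero α G := by
  obtain ⟨hG, -, F, ⟨hF, -, -, hderiv⟩, a, -, hs⟩ := h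
  exact (hderiv.holderAtZero hF h0).of_summable hF hG h1 hs

end RittProb

theorem theorem6p1 (ε : ℝ) (hε : ε ∈ Set.Ioc (0 : ℝ) 1) :
    RittProb.IsProb (RittProb.B ε) ∧
    ∀ β ∈ Set.Ioo (0 : ℝ) 1,
      RittProb.Bsub ε β ∈ RittProb.classA ∧
      (∀ᶠ ξ in 𝓝[≠] (0 : ℝ), RittProb.fourier (RittProb.Bsub ε β) ξ ≠ 1) ∧
      ∀ α ∈ Set.Ioo (0 : ℝ) 1,
        Tendsto (fun ξ : ℝ => |ξ| ^ α / ‖1 - RittProb.fourier (RittProb.Bsub ε β) ξ‖)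
          (𝓝[≠] 0) (𝓝 0) ∧
        ¬ RittProb.DerivBound α (RittProb.Bsub ε β) ∧
        ¬ RittProb.FourierCriterion α (RittProb.Bsub ε β) ∧
        ¬ RittProb.ComparisonCriterion α (RittProb.Bsub ε β) := by
  have hB := RittProb.isProb_B hε.1 hε.2
  refine ⟨hB, fun β hβ => ?_⟩
  have hBsub : RittProb.Bsub ε β ∈ RittProb.classA :=
    RittProb.subordinate_mem_classA (RittProb.A_mem_classA hβ.1 hβ.2) hB (RittProb.B_zero ε)
  refine ⟨hBsub, RittProb.eventually_fourier_Bsub_ne_one hε.1 hε.2 hβ.1 hβ.2.le, fun α hα => ?_⟩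
  have hlittle := RittProb.isLittleO_one_sub_fourier_Bsub hε.1 hε.2 hβ.1 hβ.2.le hα.1
  have hnot : ¬ RittProb.HolderAtZero α (RittProb.Bsub ε β) := fun h => h.not_isLittleO hlittle
  have hderiv : ¬ RittProb.DerivBound α (RittProb.Bsub ε β) :=
    fun h => hnot (h.holderAtZero hBsub.1 hα.1)
  exact ⟨hlittle.norm_right.tendsto_div_nhds_zero, hderiv, fun h => hderiv h.2.2.2,
    fun h => hnot (h.holderAtZero hα.1 hα.2.le)⟩
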